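/- Theorem. For a positive integer $N$ and a nonempty set $S \subseteq [N]$ let $|S\rangle = |S|^{-1/2}\sum_{i\in S}|i\rangle$, let $\mathcal{O}_S$ be the membership oracle $|i\rangle|b\rangle \mapsto |i\rangle|b\oplus[i\in S]\rangle$, and let $\mathcal{R}_S = \mathbb{1} - 2|S\rangle\langle S|$. Consider a quantum algorithm with a finite-dimensional workspace that starts with some number $R_1$ of copies of $|S\rangle$ (and a fixed initial workspace state), interleaves arbitrary unitaries independent of $S$ with $T$ uses of $\mathcal{O}_S$ and $R_2$ uses of $\mathcal{R}_S$ (possibly controlled), and finally measures in the computational basis to produce one output bit; put $R = R_1 + R_2$. There is an absolute constant $c > 0$ such that for all integers $N, w$ with $w \ge 1$ and $2w \le N$, every such algorithm that decides whether $|S| = w$ or $|S| = 2w$, promised that one of these is the case, with success probability at least $2/3$ on each such $S \subseteq [N]$, satisfies $$T \ge c\sqrt{\frac{N}{w}} \qquad\text{or}\qquad R \ge c\,\min\left\{ w^{1/4}, \sqrt{\frac{N}{w}} \right\}.$$ -/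

import Mathlib

noncomputable section

/-- Computational basis of the register machine: `r` registers of dimension `N` (for the copies of
`|S⟩`), an address register of dimension `N`, an answer/control qubit, and an ancilla register of
finite dimension `d`. -/
abbrev BasisState (N r d : ℕ) : Type :=
  (Fin r → Fin N) × Fin N × Bool × Fin d

/-- The amplitudes of `|S⟩ = |S|^{-1/2} ∑_{i ∈ S} |i⟩` (for nonempty `S`). -/
def sampleState {N : ℕ} (S : Finset (Fin N)) : Fin N → ℂ :=
  fun i => if i ∈ S then (((Real.sqrt (S.card : ℝ))⁻¹ : ℝ) : ℂ) else 0

/-- The membership oracle `O_S : |i⟩|b⟩ ↦ |i⟩|b ⊕ [i ∈ S]⟩`, acting on the address register and the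
answer qubit, as the identity on the other registers. -/
def applyQuery {N r d : ℕ} (S : Finset (Fin N)) (ψ : BasisState N r d → ℂ) :
    BasisState N r d → ℂ :=
  fun z => ψ (z.1, z.2.1, xor z.2.2.1 (decide (z.2.1 ∈ S)), z.2.2.2)

/-- The reflection `𝟙 - 2|S⟩⟨S|` acting on the address register, as the identity on the other
registers. -/
def applyReflection {N r d : ℕ} (S : Finset (Fin N)) (ψ : BasisState N r d → ℂ) :
    BasisState N r d → ℂ :=
  fun z => ψ z -
    2 * sampleState S z.2.1 * ∑ j : Fin N, star (sampleState S j) * ψ (z.1, j, z.2.2)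

/-- The reflection `𝟙 - 2|S⟩⟨S|` on the address register, controlled by the qubit. -/
def applyControlledReflection {N r d : ℕ} (S : Finset (Fin N)) (ψ : BasisState N r d → ℂ) :
    BasisState N r d → ℂ :=
  fun z => if z.2.2.1 = true then applyReflection S ψ z else ψ z

/-- The input-dependent operations that an algorithm may invoke. -/
inductive OracleCall : Type
  | query
  | reflection
  | controlledReflection

/-- The action of an oracle call on the state of the algorithm when the hidden set is `S`. -/
def OracleCall.apply {N r d : ℕ} (S : Finset (Fin N)) :
    OracleCall → (BasisState N r d → ℂ) → (BasisState N r d → ℂ)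
  | .query => applyQuery S
  | .reflection => applyReflection S
  | .controlledReflection => applyControlledReflection S

/-- Number of membership queries made by one oracle call. -/
def OracleCall.queryCost : OracleCall → ℕ
  | .query => 1
  | .reflection => 0
  | .controlledReflection => 0

/-- Number of uses of the reflection about `|S⟩` made by one oracle call. -/
def OracleCall.reflectionCost : OracleCall → ℕ
  | .query => 0
  | .reflection => 1
  | .controlledReflection => 1

/-- A quantum algorithm with access to an unknown `S ⊆ [N]` through copies of `|S⟩`, membership
queries, and reflections about `|S⟩`. It starts in `|S⟩^{⊗ copies} ⊗ |start⟩`, applies `prep`, then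
for each entry `(call, U)` of `steps`, in order, invokes `call` and applies `U`; finally it measures
in the computational basis and outputs the Boolean `output z` at outcome `z`. None of the data
depends on `S`; every unitary may act on all registers. -/
structure QuantumAlgorithm (N : ℕ) where
  copies : ℕ
  ancillaDim : ℕ
  start : Fin N × Bool × Fin ancillaDim
  prep : Matrix.unitaryGroup (BasisState N copies ancillaDim) ℂ
  steps : List (OracleCall × Matrix.unitaryGroup (BasisState N copies ancillaDim) ℂ)
  output : BasisState N copies ancillaDim → Bool

namespace QuantumAlgorithm

variable {N : ℕ}

/-- The state space of the algorithm, as amplitude vectors. -/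
abbrev State (Q : QuantumAlgorithm N) : Type :=
  BasisState N Q.copies Q.ancillaDim → ℂ

/-- `T`: the number of membership queries. -/
def queries (Q : QuantumAlgorithm N) : ℕ :=
  (Q.steps.map fun s => s.1.queryCost).sum

/-- The number of uses of the reflection about `|S⟩`. -/
def reflections (Q : QuantumAlgorithm N) : ℕ :=
  (Q.steps.map fun s => s.1.reflectionCost).sum

/-- The initial state `|S⟩^{⊗ copies} ⊗ |start⟩`. -/
def initialState (Q : QuantumAlgorithm N) (S : Finset (Fin N)) : Q.State :=
  fun z => (∏ k : Fin Q.copies, sampleState S (z.1 k)) * (if z.2 = Q.start then 1 else 0)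

/-- The state before the final measurement. -/
def finalState (Q : QuantumAlgorithm N) (S : Finset (Fin N)) : Q.State :=
  Q.steps.foldl (fun ψ s => s.2.1.mulVec (s.1.apply S ψ))
    (Q.prep.1.mulVec (Q.initialState S))

/-- The probability that the algorithm outputs `b` when the hidden set is `S`. -/
def outputProb (Q : QuantumAlgorithm N) (S : Finset (Fin N)) (b : Bool) : ℝ :=
  ∑ z : BasisState N Q.copies Q.ancillaDim,
    if Q.output z = b then ‖Q.finalState S z‖ ^ 2 else 0

/-- `Q` decides whether `|S| = k₀` (output `false`) or `|S| = k₁` (output `true`), promised that one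
of these is the case, with success probability at least `2/3` on every such `S`. -/
def Decides (Q : QuantumAlgorithm N) (k₀ k₁ : ℕ) : Prop :=
  ∀ S : Finset (Fin N),
    (S.card = k₀ → 2 / 3 ≤ Q.outputProb S false) ∧
    (S.card = k₁ → 2 / 3 ≤ Q.outputProb S true)

end QuantumAlgorithm

end

/-! The proof is the polynomial method with Laurent polynomials. Every amplitude of the final state,
multiplied by `√|S|^m` with `m = R₁ + 2R₂`, is a polynomial of degree at most `T + m` in the
indicators `[i ∈ S]`. Averaging acceptance probabilities over all `S` of size `k` therefore gives
`u(k) + v₀ + v(1/k)` with `u(0) = v(0) = 0`, `deg u ≤ 2T + m` and `deg v ≤ m`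
(`exists_laurent_averageProb`). This average lies in `[0, 1]` at all integers `1 ≤ k ≤ N`, yet jumps
from at most `1/3` at `w` to at least `2/3` at `2w`.

Such a jump needs large degree (`laurent_abs_sub_le`). Let `U`, `V` be the maxima of `|u|` on `[0,
N]` and `|v|` on `[0, 1/a]`. By Markov's inequality, `(deg u)² ≪ N/w` makes `u` at most `U/100` on
`[0, 2w]`, and `m² a ≪ w` makes `v` at most `V/100` on `[0, 1/w]`. The condition `m² ≪ a` lets
bounds at integers extend to real points of `[a, N]`. Hence `u` and `v` cannot cancel each other's
maxima, `U + V` is bounded, and the sum is nearly constant between `w` and `2w`. Both conditions on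
`a` can be met when `m⁴ ≪ w`, whence the exponent `1/4`. -/

/-! ### Markov-type inequalities and the gap bound for Laurent polynomials. -/

-- Chebyshev polynomials are extremal for the derivative at `1`, and `T_n'(1) = n * U_{n-1}(1) =
-- n²`. Applying this to `P / M` and `-P / M` bounds the absolute value.
open Polynomial in
theorem abs_eval_one_derivative_le_of_abs_le {n : ℕ} {P : ℝ[X]} (hP : P.natDegree ≤ n) {M : ℝ}
    (hM : ∀ x ∈ Set.Icc (-1 : ℝ) 1, |P.eval x| ≤ M) :
    |(derivative P).eval 1| ≤ (n : ℝ) ^ 2 * M := by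
  have key : ∀ Q : ℝ[X], Q.natDegree ≤ n → (∀ x ∈ Set.Icc (-1 : ℝ) 1, |Q.eval x| ≤ 1) →
      (derivative Q).eval 1 ≤ (n : ℝ) ^ 2 := by
    intro Q hQ hb
    have h := Chebyshev.eval_iterate_derivative_le_of_forall_abs_le_one (k := 1) (le_refl (1 : ℝ))
      (natDegree_le_iff_degree_le.mp hQ) hb
    simp only [Function.iterate_one, Chebyshev.T_derivative_eq_U] at h
    simpa [sq] using h
  have hM0 : 0 ≤ M := (abs_nonneg _).trans (hM 1 (by norm_num))
  rcases hM0.eq_or_lt with rfl | hpos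
  · have : P = 0 := by
      refine eq_zero_of_infinite_isRoot P ((Set.Icc_infinite (show (-1 : ℝ) < 1 by norm_num)).mono ?_)
      intro x hx
      exact abs_nonpos_iff.mp (hM x hx)
    simp [this]
  · have h1 := key (C M⁻¹ * P) ((natDegree_C_mul_le _ _).trans hP) (fun x hx => by
      rw [eval_mul, eval_C, abs_mul, abs_of_pos (inv_pos.mpr hpos), inv_mul_le_iff₀ hpos, mul_one]
      exact hM x hx)
    have h2 := key (C (-M⁻¹) * P) ((natDegree_C_mul_le _ _).trans hP) (fun x hx => by
      rw [eval_mul, eval_C, abs_mul, abs_neg, abs_of_pos (inv_pos.mpr hpos), inv_mul_le_iff₀ hpos,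
        mul_one]
      exact hM x hx)
    simp only [derivative_C_mul, eval_mul, eval_C, neg_mul] at h1 h2
    rw [inv_mul_le_iff₀ hpos] at h1
    rw [← mul_neg, inv_mul_le_iff₀ hpos] at h2
    rw [abs_le]
    constructor <;> linarith

open Polynomial in
/-- Markov brothers' inequality, up to a factor `2`. -/
theorem abs_eval_derivative_le_of_abs_le {n : ℕ} {P : ℝ[X]} (hP : P.natDegree ≤ n) {b M : ℝ}
    (hb : 0 < b) (hM : ∀ x ∈ Set.Icc 0 b, |P.eval x| ≤ M) {x : ℝ} (hx : x ∈ Set.Icc 0 b) :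
    |(derivative P).eval x| ≤ 4 * (n : ℝ) ^ 2 * M / b := by
  have hM0 : 0 ≤ M := (abs_nonneg _).trans (hM x hx)
  -- An affine map takes `[-1, 1]` to the segment from `y` to `x`, sending `1` to `x`. Some endpoint
  -- `y` of `[0, b]` is at distance at least `b / 2`; using only that segment costs the factor `2`.
  have key : ∀ y ∈ Set.Icc 0 b, b / 2 ≤ |x - y| →
      |(derivative P).eval x| ≤ 4 * (n : ℝ) ^ 2 * M / b := by
    intro y hy hxy
    have h := abs_eval_one_derivative_le_of_abs_le
      (P := P.comp (C ((x - y) / 2) * X + C ((x + y) / 2))) (n := n) (M := M) (by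
        refine natDegree_comp_le.trans ?_
        exact (Nat.mul_le_mul hP natDegree_linear_le).trans (by simp)) (by
        intro t ht
        simp only [eval_comp, eval_add, eval_mul, eval_C, eval_X]
        refine hM _ ⟨?_, ?_⟩ <;> nlinarith [hx.1, hx.2, hy.1, hy.2, ht.1, ht.2])
    simp only [derivative_comp, derivative_add, derivative_mul, derivative_C, derivative_X,
      eval_mul, eval_comp, eval_add, eval_C, eval_X, mul_one, zero_mul, zero_add, add_zero] at h
    rw [show (x - y) / 2 + (x + y) / 2 = x by ring, abs_mul, abs_div, abs_two] at h
    rw [le_div_iff₀ hb]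
    nlinarith [abs_nonneg ((derivative P).eval x)]
  rcases le_total (b / 2) x with h | h
  · exact key 0 ⟨le_rfl, hb.le⟩ (by rw [sub_zero]; exact h.trans (le_abs_self x))
  · exact key b ⟨hb.le, le_rfl⟩ (by rw [abs_sub_comm]; exact le_trans (by linarith) (le_abs_self _))

open Polynomial in
theorem abs_eval_sub_eval_le_of_abs_le {n : ℕ} {P : ℝ[X]} (hP : P.natDegree ≤ n) {b M : ℝ}
    (hb : 0 < b) (hM : ∀ x ∈ Set.Icc 0 b, |P.eval x| ≤ M) {x y : ℝ} (hx : x ∈ Set.Icc 0 b)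
    (hy : y ∈ Set.Icc 0 b) :
    |P.eval x - P.eval y| ≤ 4 * (n : ℝ) ^ 2 * M / b * |x - y| := by
  have h := (convex_Icc 0 b).norm_image_sub_le_of_norm_deriv_le (f := fun t => P.eval t)
    (C := 4 * (n : ℝ) ^ 2 * M / b) (fun t _ => P.differentiableAt)
    (fun t ht => by
      rw [Polynomial.deriv]
      exact abs_eval_derivative_le_of_abs_le hP hb hM ht) hy hx
  simpa using h

open Polynomial in
theorem exists_abs_eval_isMax (P : ℝ[X]) {b : ℝ} (hb : 0 ≤ b) :
    ∃ x ∈ Set.Icc 0 b, ∀ y ∈ Set.Icc 0 b, |P.eval y| ≤ |P.eval x| := by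
  obtain ⟨x, hx, h⟩ := isCompact_Icc.exists_isMaxOn (Set.nonempty_Icc.mpr hb)
    (f := fun t => |P.eval t|) (P.continuous.abs.continuousOn)
  exact ⟨x, hx, fun y hy => h hy⟩

open Polynomial in
/-- A Laurent polynomial `u(x) + v₀ + v(1/x)` of small positive and negative degree that is bounded
by `1` at the integers of `[a, N]` varies little between `w` and `2w`. -/
theorem laurent_abs_sub_le {N w a D m : ℕ} {u v : ℝ[X]} {v₀ : ℝ} (hu : u.natDegree ≤ D)
    (hv : v.natDegree ≤ m) (hu0 : u.eval 0 = 0) (hv0 : v.eval 0 = 0) (ha : 1 ≤ a) (haw : a ≤ w)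
    (hwN : 2 * w ≤ N)
    (hr : ∀ k : ℕ, a ≤ k → k ≤ N → |u.eval (k : ℝ) + v₀ + v.eval (k : ℝ)⁻¹| ≤ 1)
    (hD : 800 * w * D ^ 2 ≤ N) (hm : 400 * m ^ 2 ≤ a) (hma : 400 * m ^ 2 * a ≤ w) :
    |(u.eval (2 * w : ℝ) + v₀ + v.eval (2 * w : ℝ)⁻¹) - (u.eval (w : ℝ) + v₀ + v.eval (w : ℝ)⁻¹)|
      ≤ 1 / 10 := by
  have ha' : (1 : ℝ) ≤ a := by exact_mod_cast ha
  have haw' : (a : ℝ) ≤ w := by exact_mod_cast haw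
  have hwN' : 2 * (w : ℝ) ≤ N := by exact_mod_cast hwN
  have hD' : 800 * (w : ℝ) * (D : ℝ) ^ 2 ≤ N := by exact_mod_cast hD
  have hm' : 400 * (m : ℝ) ^ 2 ≤ a := by exact_mod_cast hm
  have hma' : 400 * (m : ℝ) ^ 2 * a ≤ w := by exact_mod_cast hma
  have ha0 : (0 : ℝ) < a := by linarith
  have hw0 : (0 : ℝ) < w := by linarith
  have hN0 : (0 : ℝ) < N := by linarith
  obtain ⟨xu, hxu, hU⟩ := exists_abs_eval_isMax u hN0.le
  obtain ⟨yv, hyv, hV⟩ := exists_abs_eval_isMax v (inv_pos.mpr ha0).le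
  set U := |u.eval xu| with hUdef
  set V := |v.eval yv| with hVdef
  have hU0 : 0 ≤ U := abs_nonneg _
  have hV0 : 0 ≤ V := abs_nonneg _
  have hDN : (D : ℝ) ^ 2 / N ≤ 1 / (800 * w) := by
    rw [div_le_div_iff₀ hN0 (by positivity)]; linarith
  have lu : ∀ x ∈ Set.Icc (0 : ℝ) N, ∀ y ∈ Set.Icc (0 : ℝ) N,
      |u.eval x - u.eval y| ≤ U / (200 * w) * |x - y| := by
    intro x hx y hy
    refine (abs_eval_sub_eval_le_of_abs_le hu hN0 hU hx hy).trans
      (mul_le_mul_of_nonneg_right ?_ (abs_nonneg _))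
    calc 4 * (D : ℝ) ^ 2 * U / N = 4 * U * ((D : ℝ) ^ 2 / N) := by ring
      _ ≤ 4 * U * (1 / (800 * w)) := by gcongr
      _ = U / (200 * w) := by field_simp; ring
  have lv : ∀ x ∈ Set.Icc (0 : ℝ) (a : ℝ)⁻¹, ∀ y ∈ Set.Icc (0 : ℝ) (a : ℝ)⁻¹,
      |v.eval x - v.eval y| ≤ 4 * (m : ℝ) ^ 2 * V * a * |x - y| := by
    intro x hx y hy
    have := abs_eval_sub_eval_le_of_abs_le hv (inv_pos.mpr ha0) hV hx hy
    rwa [div_inv_eq_mul] at this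
  have su : ∀ x ∈ Set.Icc (0 : ℝ) (2 * w), |u.eval x| ≤ U / 100 := by
    intro x hx
    have := lu x ⟨hx.1, hx.2.trans hwN'⟩ 0 ⟨le_rfl, hN0.le⟩
    rw [hu0, sub_zero, sub_zero, abs_of_nonneg hx.1] at this
    refine this.trans ?_
    calc U / (200 * w) * x ≤ U / (200 * w) * (2 * w) := by gcongr; exact hx.2
      _ = U / 100 := by field_simp; ring
  have sv : ∀ y ∈ Set.Icc (0 : ℝ) (w : ℝ)⁻¹, |v.eval y| ≤ V / 100 := by
    intro y hy
    have := lv y ⟨hy.1, hy.2.trans (inv_anti₀ ha0 haw')⟩ 0 ⟨le_rfl, (inv_pos.mpr ha0).le⟩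
    rw [hv0, sub_zero, sub_zero, abs_of_nonneg hy.1] at this
    refine this.trans ?_
    calc 4 * (m : ℝ) ^ 2 * V * a * y ≤ 4 * (m : ℝ) ^ 2 * V * a * (w : ℝ)⁻¹ := by gcongr; exact hy.2
      _ = (400 * (m : ℝ) ^ 2 * a) * V / 100 * (w : ℝ)⁻¹ := by ring
      _ ≤ w * V / 100 * (w : ℝ)⁻¹ := by gcongr
      _ = V / 100 := by field_simp
  have sr : ∀ x ∈ Set.Icc (a : ℝ) N, |u.eval x + v₀ + v.eval x⁻¹| ≤ 1 + (U + V) / 100 := by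
    intro x hx
    have hx0 : 0 < x := ha0.trans_le hx.1
    have hk1 : a ≤ ⌊x⌋₊ := Nat.le_floor hx.1
    have hk2 : ⌊x⌋₊ ≤ N := Nat.floor_le_of_le hx.2
    have hkx : (⌊x⌋₊ : ℝ) ≤ x := Nat.floor_le hx0.le
    have hxk : x < ⌊x⌋₊ + 1 := Nat.lt_floor_add_one x
    have h0 := hr _ hk1 hk2
    have hak : (a : ℝ) ≤ (⌊x⌋₊ : ℝ) := by exact_mod_cast hk1
    set k : ℝ := (⌊x⌋₊ : ℝ) with hk
    have hk0 : 0 < k := ha0.trans_le hak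
    have h1 : |u.eval x - u.eval k| ≤ U / 100 := by
      refine (lu x ⟨hx0.le, hx.2⟩ k ⟨hk0.le, hkx.trans hx.2⟩).trans ?_
      have : |x - k| ≤ 1 := by rw [abs_of_nonneg (by linarith)]; linarith
      calc U / (200 * w) * |x - k| ≤ U / (200 * w) * 1 := by gcongr
        _ ≤ U / 100 := by
          rw [mul_one]
          gcongr
          linarith
    -- Reciprocals of points of `[a, N]` at distance at most `1` differ by at most `1/a²`, which
    -- against the Lipschitz constant `4m²Va` leaves `4m²V/a`.
    have h2 : |v.eval x⁻¹ - v.eval k⁻¹| ≤ V / 100 := by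
      refine (lv _ ⟨(inv_pos.mpr hx0).le, inv_anti₀ ha0 hx.1⟩ _
        ⟨(inv_pos.mpr hk0).le, inv_anti₀ ha0 hak⟩).trans ?_
      have hd : |x⁻¹ - k⁻¹| ≤ 1 / (a : ℝ) ^ 2 := by
        rw [abs_sub_comm, abs_of_nonneg (sub_nonneg.mpr (inv_anti₀ hk0 hkx)),
          inv_sub_inv hk0.ne' hx0.ne']
        refine div_le_div₀ zero_le_one (by linarith) (by positivity) ?_
        nlinarith [hx.1]
      calc 4 * (m : ℝ) ^ 2 * V * a * |x⁻¹ - k⁻¹| ≤ 4 * (m : ℝ) ^ 2 * V * a * (1 / (a : ℝ) ^ 2) := by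
            gcongr
        _ = (400 * (m : ℝ) ^ 2) * (V / 100 * (1 / a)) := by field_simp; ring
        _ ≤ a * (V / 100 * (1 / a)) := by gcongr
        _ = V / 100 := by field_simp
    rw [abs_le] at *
    constructor <;> linarith
  have h0w : (w : ℝ) ∈ Set.Icc (0 : ℝ) (2 * w) := ⟨hw0.le, by linarith⟩
  have hw_inv : (w : ℝ)⁻¹ ∈ Set.Icc (0 : ℝ) (w : ℝ)⁻¹ := ⟨(inv_pos.mpr hw0).le, le_rfl⟩
  have u1 := su w h0w
  have u2 := su (2 * w) ⟨by linarith, le_rfl⟩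
  have v1 := sv _ hw_inv
  have v2 := sv (2 * w : ℝ)⁻¹ ⟨by positivity, inv_anti₀ hw0 (by linarith)⟩
  have c1 := hr w haw (by omega)
  have hv₀ : |v₀| ≤ 1 + (U + V) / 100 := by
    rw [abs_le] at *
    constructor <;> linarith
  -- If the maximum is attained left of `w`, then `U ≤ U/100`. Otherwise `v` is small at the
  -- reciprocal point, so `u` is controlled by the whole sum and `v₀`.
  have bU : U ≤ 2 + 3 * (U + V) / 100 := by
    rcases le_total xu w with h | h
    · have := su xu ⟨hxu.1, by linarith⟩
      linarith
    · have h1 := sr xu ⟨haw'.trans h, hxu.2⟩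
      have h2 := sv xu⁻¹ ⟨inv_nonneg.mpr hxu.1, inv_anti₀ hw0 h⟩
      rw [abs_le] at h1 h2 hv₀
      rw [hUdef, abs_le, ← hUdef]
      constructor <;> linarith
  have bV : V ≤ 2 + 3 * (U + V) / 100 := by
    rcases le_total yv (w : ℝ)⁻¹ with h | h
    · have := sv yv ⟨hyv.1, h⟩
      linarith
    · have hy0 : 0 < yv := (inv_pos.mpr hw0).trans_le h
      have hyw : yv⁻¹ ≤ w := by rw [inv_le_comm₀ hy0 hw0]; exact h
      have h1 := sr yv⁻¹ ⟨by rw [le_inv_comm₀ ha0 hy0]; exact hyv.2, by linarith⟩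
      have h2 := su yv⁻¹ ⟨(inv_pos.mpr hy0).le, by linarith⟩
      rw [inv_inv] at h1
      rw [abs_le] at h1 h2 hv₀
      rw [hVdef, abs_le, ← hVdef]
      constructor <;> linarith
  have hUV : U + V ≤ 5 := by linarith
  rw [abs_le] at *
  constructor <;> linarith

/-! ### Polynomials in the indicator variables and symmetrization. -/

/-- The functions of `S ⊆ [N]` that are polynomials of degree at most `d` in the indicator
variables of the elements. -/
def lowDegree (N d : ℕ) : Submodule ℂ (Finset (Fin N) → ℂ) :=
  Submodule.span ℂ
    {f | ∃ A : Finset (Fin N), A.card ≤ d ∧ f = fun S => if A ⊆ S then 1 else 0}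

theorem lowDegree_mono {N d e : ℕ} (h : d ≤ e) : lowDegree N d ≤ lowDegree N e := by
  refine Submodule.span_mono ?_
  rintro f ⟨A, hA, rfl⟩
  exact ⟨A, hA.trans h, rfl⟩

theorem mul_mem_lowDegree {N d e : ℕ} {f g : Finset (Fin N) → ℂ} (hf : f ∈ lowDegree N d)
    (hg : g ∈ lowDegree N e) : f * g ∈ lowDegree N (d + e) := by
  have h : lowDegree N d * lowDegree N e ≤ lowDegree N (d + e) := by
    rw [lowDegree, lowDegree, Submodule.span_mul_span]
    refine Submodule.span_mono ?_
    rintro _ ⟨_, ⟨A, hA, rfl⟩, _, ⟨B, hB, rfl⟩, rfl⟩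
    refine ⟨A ∪ B, (Finset.card_union_le A B).trans (Nat.add_le_add hA hB), ?_⟩
    funext S
    by_cases hAS : A ⊆ S <;> by_cases hBS : B ⊆ S <;> simp [Finset.union_subset_iff, hAS, hBS]
  exact h (Submodule.mul_mem_mul hf hg)

theorem star_mem_lowDegree {N d : ℕ} {f : Finset (Fin N) → ℂ} (hf : f ∈ lowDegree N d) :
    star f ∈ lowDegree N d := by
  induction hf using Submodule.span_induction with
  | mem f hf =>
    obtain ⟨A, hA, rfl⟩ := hf
    refine Submodule.subset_span ⟨A, hA, ?_⟩
    funext S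
    simp [apply_ite]
  | zero => simp
  | add f g _ _ hf hg => rw [star_add]; exact add_mem hf hg
  | smul c f _ hf => rw [star_smul]; exact Submodule.smul_mem _ _ hf

theorem indicator_mem_lowDegree {N : ℕ} (i : Fin N) :
    (fun S : Finset (Fin N) => if i ∈ S then (1 : ℂ) else 0) ∈ lowDegree N 1 :=
  Submodule.subset_span ⟨{i}, by simp, by funext S; simp⟩

theorem card_mem_lowDegree (N : ℕ) :
    (fun S : Finset (Fin N) => (S.card : ℂ)) ∈ lowDegree N 1 := by
  have : (fun S : Finset (Fin N) => (S.card : ℂ)) =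
      ∑ i : Fin N, fun S : Finset (Fin N) => if i ∈ S then (1 : ℂ) else 0 := by
    funext S
    simp
  rw [this]
  exact sum_mem fun i _ => indicator_mem_lowDegree i

theorem prod_indicator_mem_lowDegree {N r : ℕ} (x : Fin r → Fin N) :
    (fun S : Finset (Fin N) => ∏ k, if x k ∈ S then (1 : ℂ) else 0) ∈ lowDegree N r := by
  refine Submodule.subset_span ⟨Finset.univ.image x, ?_, ?_⟩
  · exact Finset.card_image_le.trans (by simp)
  · funext S
    rw [Finset.prod_ite_zero]
    simp [Finset.image_subset_iff]

open Polynomial in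
/-- Symmetrization: the average of a degree-`d` function over the `k`-subsets is a polynomial of
degree at most `d` in `k`. -/
theorem exists_polynomial_sum_powersetCard {N d : ℕ} {f : Finset (Fin N) → ℂ}
    (hf : f ∈ lowDegree N d) :
    ∃ p : ℂ[X], p.natDegree ≤ d ∧ ∀ k ≤ N,
      ∑ S ∈ Finset.univ.powersetCard k, f S = (N.choose k : ℂ) * p.eval (k : ℂ) := by
  induction hf using Submodule.span_induction with
  | mem f hf =>
    obtain ⟨A, hA, rfl⟩ := hf
    have hAN : A.card ≤ N := by simpa using Finset.card_le_univ A
    have h0 : (N.choose A.card : ℂ) ≠ 0 := by exact_mod_cast (Nat.choose_pos hAN).ne'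
    have h1 : (A.card.factorial : ℂ) ≠ 0 := by exact_mod_cast A.card.factorial_ne_zero
    refine ⟨C ((A.card.factorial : ℂ)⁻¹ * (N.choose A.card : ℂ)⁻¹) * descPochhammer ℂ A.card, ?_, ?_⟩
    · exact (natDegree_C_mul_le _ _).trans (by rwa [descPochhammer_natDegree])
    · intro k hk
      have hcount : ∑ S ∈ Finset.univ.powersetCard k, (if A ⊆ S then (1 : ℂ) else 0) =
          (((Finset.univ.powersetCard k).filter (A ⊆ ·)).card : ℂ) := by
        rw [Finset.sum_boole]
      have heval : (C ((A.card.factorial : ℂ)⁻¹ * (N.choose A.card : ℂ)⁻¹) *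
          descPochhammer ℂ A.card).eval (k : ℂ) = (k.choose A.card : ℂ) / N.choose A.card := by
        rw [Nat.cast_choose_eq_descPochhammer_div ℂ k A.card, eval_mul, eval_C]
        field_simp
      rw [hcount, heval, mul_div_assoc', eq_div_iff h0]
      rcases le_or_gt A.card k with hAk | hAk
      · rw [Finset.card_filter_powersetCard_subset A Finset.univ k (Finset.subset_univ _) hAk]
        have := Nat.choose_mul (n := N) hAk
        rw [Finset.card_univ, Fintype.card_fin]
        exact_mod_cast (this.trans (mul_comm _ _)).symm
      -- For `k < |A|` no `k`-subset contains `A`, and the falling factorial vanishes too, so the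
      -- formula needs no lower bound on `k`.
      · rw [Nat.choose_eq_zero_of_lt hAk, Finset.card_eq_zero.mpr]
        · simp
        · refine Finset.filter_eq_empty_iff.mpr fun S hS hAS => ?_
          have := Finset.card_le_card hAS
          rw [(Finset.mem_powersetCard.mp hS).2] at this
          omega
  | zero => exact ⟨0, by simp, by simp⟩
  | add f g _ _ hf hg =>
    obtain ⟨p, hp, hp'⟩ := hf
    obtain ⟨q, hq, hq'⟩ := hg
    refine ⟨p + q, natDegree_add_le_of_degree_le hp hq, fun k hk => ?_⟩
    simp only [Pi.add_apply, Finset.sum_add_distrib, hp' k hk, hq' k hk, eval_add, mul_add]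
  | smul c f _ hf =>
    obtain ⟨p, hp, hp'⟩ := hf
    refine ⟨C c * p, (natDegree_C_mul_le _ _).trans hp, fun k hk => ?_⟩
    simp only [Pi.smul_apply, smul_eq_mul, ← Finset.mul_sum, hp' k hk, eval_mul, eval_C]
    ring

open Polynomial in
theorem exists_real_polynomial_re {d : ℕ} {p : ℂ[X]} (hp : p.natDegree ≤ d) :
    ∃ P : ℝ[X], P.natDegree ≤ d ∧ ∀ x : ℝ, P.eval x = (p.eval (x : ℂ)).re := by
  refine ⟨∑ i ∈ Finset.range (d + 1), C (p.coeff i).re * X ^ i, ?_, fun x => ?_⟩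
  · refine natDegree_sum_le_of_forall_le _ _ fun i hi => ?_
    exact (natDegree_C_mul_X_pow_le _ _).trans (Nat.lt_succ_iff.mp (Finset.mem_range.mp hi))
  · rw [eval_eq_sum_range' (Nat.lt_succ_of_le hp), Complex.re_sum, eval_finsetSum]
    refine Finset.sum_congr rfl fun i _ => ?_
    rw [← Complex.ofReal_pow, Complex.re_mul_ofReal]
    simp

-- Each division by `x` splits off the constant coefficient, which becomes the next higher power of
-- `1/x`.
open Polynomial in
theorem exists_laurent_decomposition {D m : ℕ} {P : ℝ[X]} (hP : P.natDegree ≤ D + m) :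
    ∃ (u v : ℝ[X]) (v₀ : ℝ), u.natDegree ≤ D ∧ v.natDegree ≤ m ∧ u.eval 0 = 0 ∧ v.eval 0 = 0 ∧
      ∀ x : ℝ, x ≠ 0 → P.eval x / x ^ m = u.eval x + v₀ + v.eval x⁻¹ := by
  induction m generalizing P with
  | zero =>
    refine ⟨P - C (P.eval 0), 0, P.eval 0, ?_, by simp, by simp, by simp, by simp⟩
    rw [natDegree_sub_C]
    exact hP
  | succ m ih =>
    obtain ⟨u, v, v₀, hu, hv, hu0, hv0, h⟩ := ih (P := P.divX) (by
      rw [natDegree_divX_eq_natDegree_tsub_one]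
      omega)
    refine ⟨u, v + C (P.coeff 0) * X ^ (m + 1), v₀, hu, ?_, hu0, by simp [hv0], fun x hx => ?_⟩
    · exact natDegree_add_le_of_degree_le (hv.trans (Nat.le_succ m)) (natDegree_C_mul_X_pow_le _ _)
    · have hx' := h x hx
      conv_lhs => rw [← divX_mul_X_add P]
      simp only [eval_add, eval_mul, eval_X, eval_C, eval_pow]
      rw [← add_assoc, ← hx', inv_pow]
      field_simp
      ring

/-! ### Degrees of the amplitudes. -/

section

/-- `√|S|^e` times every amplitude of `ψ S` is a polynomial of degree at most `n` in the indicator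
variables of `S`, for nonempty `S`. -/
def HasAmplitudeDegree {N : ℕ} {ι : Type} (e n : ℕ) (ψ : Finset (Fin N) → ι → ℂ) : Prop :=
  ∀ z, ∃ f ∈ lowDegree N n, ∀ S : Finset (Fin N), S.Nonempty →
    f S = (Real.sqrt S.card : ℂ) ^ e * ψ S z

namespace HasAmplitudeDegree

variable {N : ℕ}

theorem mulVec {ι : Type} [Fintype ι] {e n : ℕ} {ψ : Finset (Fin N) → ι → ℂ}
    (h : HasAmplitudeDegree e n ψ) (U : Matrix ι ι ℂ) :
    HasAmplitudeDegree e n fun S => U.mulVec (ψ S) := by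
  intro z
  choose f hf hf' using h
  refine ⟨∑ y, U z y • f y, sum_mem fun y _ => Submodule.smul_mem _ _ (hf y), fun S hS => ?_⟩
  simp only [Finset.sum_apply, Pi.smul_apply, smul_eq_mul, hf' _ S hS, Matrix.mulVec, dotProduct,
    Finset.mul_sum]
  exact Finset.sum_congr rfl fun y _ => by ring

variable {r d : ℕ} {e n : ℕ} {ψ : Finset (Fin N) → BasisState N r d → ℂ}

theorem query (h : HasAmplitudeDegree e n ψ) :
    HasAmplitudeDegree e (n + 1) fun S => applyQuery S (ψ S) := by
  rintro ⟨x, i, b, y⟩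
  obtain ⟨f, hf, hf'⟩ := h (x, i, b, y)
  obtain ⟨g, hg, hg'⟩ := h (x, i, !b, y)
  -- The query selects one of two old amplitudes according to `[i ∈ S]`.
  refine ⟨f + (g - f) * fun S => if i ∈ S then 1 else 0,
    add_mem (lowDegree_mono (Nat.le_succ n) hf)
      (mul_mem_lowDegree (sub_mem hg hf) (indicator_mem_lowDegree i)), fun S hS => ?_⟩
  by_cases hi : i ∈ S <;> simp [applyQuery, hi, hf' S hS, hg' S hS]

/-- Since `√|S|²` is the sum of the indicators, the normalization can be raised at the cost of one
degree. This aligns amplitudes left unchanged by a reflection with those it changes. -/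
theorem mul_card (h : HasAmplitudeDegree e n ψ) : HasAmplitudeDegree (e + 2) (n + 1) ψ := by
  intro z
  obtain ⟨f, hf, hf'⟩ := h z
  refine ⟨f * fun S => (S.card : ℂ), mul_mem_lowDegree hf (card_mem_lowDegree N), fun S hS => ?_⟩
  have hsq : (Real.sqrt S.card : ℂ) ^ 2 = S.card := by
    rw [← Complex.ofReal_pow, Real.sq_sqrt (Nat.cast_nonneg _), Complex.ofReal_natCast]
  rw [Pi.mul_apply, hf' S hS, pow_add, hsq]
  ring

theorem mono {n' : ℕ} (h : HasAmplitudeDegree e n ψ) (hn : n ≤ n') :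
    HasAmplitudeDegree e n' ψ := fun z =>
  let ⟨f, hf, hf'⟩ := h z
  ⟨f, lowDegree_mono hn hf, hf'⟩

/-- The entries of `|S⟩⟨S|` are `[i ∈ S][j ∈ S] / |S|`, so two further factors `√|S|` clear the
denominator and the two indicators add degree `2`. -/
theorem reflection (h : HasAmplitudeDegree e n ψ) :
    HasAmplitudeDegree (e + 2) (n + 2) fun S => applyReflection S (ψ S) := by
  rintro ⟨x, i, t⟩
  obtain ⟨f, hf, hf'⟩ := h.mul_card (x, i, t)
  have hj : ∀ j : Fin N, ∃ g ∈ lowDegree N n, ∀ S : Finset (Fin N), S.Nonempty →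
      g S = (Real.sqrt S.card : ℂ) ^ e * ψ S (x, j, t) := fun j => h (x, j, t)
  choose g hg hg' using hj
  let χ : Fin N → Finset (Fin N) → ℂ := fun j S => if j ∈ S then 1 else 0
  have hχ : ∀ j, χ j ∈ lowDegree N 1 := indicator_mem_lowDegree
  have hsum : ∑ j, g j * χ j ∈ lowDegree N (n + 1) :=
    sum_mem fun j _ => mul_mem_lowDegree (hg j) (hχ j)
  have hprod : (∑ j, g j * χ j) * χ i ∈ lowDegree N (n + 1 + 1) :=
    mul_mem_lowDegree hsum (hχ i)
  refine ⟨f - (2 : ℂ) • ((∑ j, g j * χ j) * χ i),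
    sub_mem (lowDegree_mono (Nat.le_succ _) hf) (Submodule.smul_mem _ _ hprod), fun S hS => ?_⟩
  have hk : (Real.sqrt S.card : ℂ) ≠ 0 := by
    rw [Complex.ofReal_ne_zero]
    exact (Real.sqrt_pos.mpr (by exact_mod_cast hS.card_pos)).ne'
  simp only [Pi.sub_apply, hf' S hS, Pi.smul_apply, Pi.mul_apply, Finset.sum_apply, smul_eq_mul,
    applyReflection, hg' _ S hS, mul_sub]
  congr 1
  rw [Finset.sum_mul, Finset.mul_sum, Finset.mul_sum, Finset.mul_sum]
  refine Finset.sum_congr rfl fun j _ => ?_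
  by_cases hi : i ∈ S <;> by_cases hj : j ∈ S <;> simp [χ, sampleState, hi, hj]
  field_simp
  ring

theorem controlledReflection (h : HasAmplitudeDegree e n ψ) :
    HasAmplitudeDegree (e + 2) (n + 2) fun S => applyControlledReflection S (ψ S) := by
  intro z
  by_cases hb : z.2.2.1 = true
  · simpa only [applyControlledReflection, hb, if_true] using h.reflection z
  · simpa only [applyControlledReflection, if_neg hb] using (h.mul_card.mono (Nat.le_succ _)) z

theorem oracleCall (h : HasAmplitudeDegree e n ψ) (c : OracleCall) :
    HasAmplitudeDegree (e + 2 * c.reflectionCost) (n + (c.queryCost + 2 * c.reflectionCost))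
      fun S => c.apply S (ψ S) := by
  cases c with
  | query => exact h.query
  | reflection => exact h.reflection
  | controlledReflection => exact h.controlledReflection

theorem steps (l : List (OracleCall × Matrix.unitaryGroup (BasisState N r d) ℂ))
    (h : HasAmplitudeDegree e n ψ) :
    HasAmplitudeDegree (e + 2 * (l.map fun s => s.1.reflectionCost).sum)
      (n + ((l.map fun s => s.1.queryCost).sum + 2 * (l.map fun s => s.1.reflectionCost).sum))
      fun S => l.foldl (fun φ s => s.2.1.mulVec (s.1.apply S φ)) (ψ S) := by
  induction l generalizing e n ψ with
  | nil => exact h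
  | cons s l ih =>
    have := ih ((h.oracleCall s.1).mulVec s.2.1)
    simp only [List.map_cons, List.sum_cons, List.foldl_cons]
    convert this using 1 <;> ring

end HasAmplitudeDegree

namespace QuantumAlgorithm

variable {N : ℕ}

theorem hasAmplitudeDegree_initialState (Q : QuantumAlgorithm N) :
    HasAmplitudeDegree Q.copies Q.copies Q.initialState := by
  intro z
  refine ⟨(if z.2 = Q.start then (1 : ℂ) else 0) •
    fun S : Finset (Fin N) => ∏ k, if z.1 k ∈ S then (1 : ℂ) else 0,
    Submodule.smul_mem _ _ (prod_indicator_mem_lowDegree z.1), fun S hS => ?_⟩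
  have hk : (Real.sqrt S.card : ℂ) ≠ 0 := by
    rw [Complex.ofReal_ne_zero]
    exact (Real.sqrt_pos.mpr (by exact_mod_cast hS.card_pos)).ne'
  have hprod : (Real.sqrt S.card : ℂ) ^ Q.copies * ∏ k, sampleState S (z.1 k) =
      ∏ k, if z.1 k ∈ S then (1 : ℂ) else 0 := by
    have : (Real.sqrt S.card : ℂ) ^ Q.copies = ∏ _k : Fin Q.copies, (Real.sqrt S.card : ℂ) := by
      simp
    rw [this, ← Finset.prod_mul_distrib]
    refine Finset.prod_congr rfl fun k _ => ?_
    by_cases h : z.1 k ∈ S <;> simp [sampleState, h, hk]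
  rw [Pi.smul_apply, smul_eq_mul, ← hprod, initialState]
  ring

theorem hasAmplitudeDegree_finalState (Q : QuantumAlgorithm N) :
    HasAmplitudeDegree (Q.copies + 2 * Q.reflections)
      (Q.copies + (Q.queries + 2 * Q.reflections)) Q.finalState :=
  (Q.hasAmplitudeDegree_initialState.mulVec Q.prep.1).steps Q.steps

/-- Squaring moduli doubles the degree, since conjugation preserves it, and turns powers of `√|S|`
into powers of `|S|`. -/
theorem exists_lowDegree_outputProb (Q : QuantumAlgorithm N) (b : Bool) :
    ∃ f ∈ lowDegree N (2 * (Q.copies + (Q.queries + 2 * Q.reflections))),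
      ∀ S : Finset (Fin N), S.Nonempty →
        f S = (S.card : ℂ) ^ (Q.copies + 2 * Q.reflections) * (Q.outputProb S b : ℂ) := by
  choose f hf hf' using Q.hasAmplitudeDegree_finalState
  refine ⟨∑ z, if Q.output z = b then f z * star (f z) else 0, sum_mem fun z _ => ?_,
    fun S hS => ?_⟩
  · split_ifs
    · rw [two_mul]
      exact mul_mem_lowDegree (hf z) (star_mem_lowDegree (hf z))
    · exact zero_mem _
  · rw [outputProb, Complex.ofReal_sum, Finset.mul_sum, Finset.sum_apply]
    refine Finset.sum_congr rfl fun z _ => ?_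
    split_ifs with h
    · have hsq : (Real.sqrt S.card : ℂ) ^ 2 = S.card := by
        rw [← Complex.ofReal_pow, Real.sq_sqrt (Nat.cast_nonneg _), Complex.ofReal_natCast]
      rw [Pi.mul_apply, Pi.star_apply, hf' z S hS, ← hsq, Complex.ofReal_pow, ← Complex.mul_conj',
        star_mul', star_pow, ← Complex.ofReal_pow]
      simp only [Complex.star_def, Complex.conj_ofReal, Complex.ofReal_pow]
      ring
    · simp

end QuantumAlgorithm

/-! ### Norm preservation: the output probabilities sum to one. -/

theorem sum_norm_sq_sub_reflection {ι : Type} [Fintype ι] (s φ : ι → ℂ)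
    (hs : ∑ i, ‖s i‖ ^ 2 = 1) :
    ∑ i, ‖φ i - 2 * s i * ∑ j, star (s j) * φ j‖ ^ 2 = ∑ i, ‖φ i‖ ^ 2 := by
  apply Complex.ofReal_injective
  have hs' : ∑ i, star (s i) * s i = 1 := by
    rw [← Complex.ofReal_one, ← hs, Complex.ofReal_sum]
    refine Finset.sum_congr rfl fun i _ => ?_
    rw [Complex.ofReal_pow, ← Complex.conj_mul', Complex.star_def]
  have hc : star (∑ j, star (s j) * φ j) = ∑ j, star (φ j) * s j := by
    rw [star_sum]
    exact Finset.sum_congr rfl fun j _ => by rw [star_mul, star_star]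
  set c := ∑ j, star (s j) * φ j with hcdef
  have expand : ∀ i, (((‖φ i - 2 * s i * c‖ ^ 2 : ℝ)) : ℂ) = ((‖φ i‖ ^ 2 : ℝ) : ℂ) -
      2 * c * (star (φ i) * s i) - 2 * star c * (star (s i) * φ i) +
      4 * (star c * c) * (star (s i) * s i) := by
    intro i
    rw [Complex.ofReal_pow, Complex.ofReal_pow, ← Complex.conj_mul', ← Complex.conj_mul',
      ← Complex.star_def, star_sub, star_mul', star_mul']
    simp only [Complex.star_def, Complex.conj_ofNat]
    ring
  rw [Complex.ofReal_sum, Complex.ofReal_sum, Finset.sum_congr rfl fun i _ => expand i,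
    Finset.sum_add_distrib, Finset.sum_sub_distrib, Finset.sum_sub_distrib, ← Finset.mul_sum,
    ← Finset.mul_sum, ← Finset.mul_sum, hs', ← hc, ← hcdef]
  ring

theorem sum_norm_sq_mulVec {ι : Type} [Fintype ι] [DecidableEq ι] (U : Matrix.unitaryGroup ι ℂ)
    (φ : ι → ℂ) : ∑ i, ‖U.1.mulVec φ i‖ ^ 2 = ∑ i, ‖φ i‖ ^ 2 := by
  have key : ∀ χ : ι → ℂ, ((∑ i, ‖χ i‖ ^ 2 : ℝ) : ℂ) = dotProduct (star χ) χ := by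
    intro χ
    rw [Complex.ofReal_sum, dotProduct]
    refine Finset.sum_congr rfl fun i _ => ?_
    rw [Complex.ofReal_pow, ← Complex.conj_mul', Pi.star_apply, Complex.star_def]
  apply Complex.ofReal_injective
  rw [key, key, Matrix.star_mulVec, Matrix.dotProduct_mulVec, Matrix.vecMul_vecMul,
    ← Matrix.star_eq_conjTranspose, Matrix.mem_unitaryGroup_iff'.mp U.2, Matrix.vecMul_one]

theorem sum_norm_sq_sampleState {N : ℕ} {S : Finset (Fin N)} (hS : S.Nonempty) :
    ∑ i, ‖sampleState S i‖ ^ 2 = 1 := by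
  have h : ∀ i, ‖sampleState S i‖ ^ 2 = if i ∈ S then (S.card : ℝ)⁻¹ else 0 := by
    intro i
    by_cases hi : i ∈ S
    · simp only [sampleState, hi, if_true, Complex.norm_real, norm_inv, Real.norm_eq_abs, inv_pow,
        sq_abs, Real.sq_sqrt (Nat.cast_nonneg _)]
    · simp [sampleState, hi]
  have hk : (S.card : ℝ) ≠ 0 := by exact_mod_cast hS.card_pos.ne'
  rw [Finset.sum_congr rfl fun i _ => h i]
  simp [hk]

variable {N r d : ℕ}

theorem sum_basisState (F : BasisState N r d → ℝ) :
    ∑ z, F z = ∑ x, ∑ t, ∑ i, F (x, i, t) := by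
  rw [Fintype.sum_prod_type]
  refine Finset.sum_congr rfl fun x _ => ?_
  rw [Fintype.sum_prod_type, Finset.sum_comm]

theorem sum_norm_sq_applyQuery (S : Finset (Fin N)) (ψ : BasisState N r d → ℂ) :
    ∑ z, ‖applyQuery S ψ z‖ ^ 2 = ∑ z, ‖ψ z‖ ^ 2 := by
  have hinv : Function.Involutive (fun z : BasisState N r d =>
      ((z.1, z.2.1, xor z.2.2.1 (decide (z.2.1 ∈ S)), z.2.2.2) : BasisState N r d)) := by
    rintro ⟨x, i, b, y⟩
    simp
  exact Equiv.sum_comp (hinv.toPerm _) fun z => ‖ψ z‖ ^ 2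

theorem sum_norm_sq_applyReflection {S : Finset (Fin N)} (hS : S.Nonempty)
    (ψ : BasisState N r d → ℂ) : ∑ z, ‖applyReflection S ψ z‖ ^ 2 = ∑ z, ‖ψ z‖ ^ 2 := by
  rw [sum_basisState, sum_basisState]
  refine Finset.sum_congr rfl fun x _ => Finset.sum_congr rfl fun t _ => ?_
  exact sum_norm_sq_sub_reflection (sampleState S) (fun i => ψ (x, i, t))
    (sum_norm_sq_sampleState hS)

theorem sum_norm_sq_applyControlledReflection {S : Finset (Fin N)} (hS : S.Nonempty)
    (ψ : BasisState N r d → ℂ) :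
    ∑ z, ‖applyControlledReflection S ψ z‖ ^ 2 = ∑ z, ‖ψ z‖ ^ 2 := by
  rw [sum_basisState, sum_basisState]
  refine Finset.sum_congr rfl fun x _ => Finset.sum_congr rfl fun t _ => ?_
  by_cases ht : t.1 = true
  · simp only [applyControlledReflection, ht, if_true]
    exact sum_norm_sq_sub_reflection (sampleState S) (fun i => ψ (x, i, t))
      (sum_norm_sq_sampleState hS)
  · simp only [applyControlledReflection, if_neg ht]

theorem OracleCall.sum_norm_sq_apply {S : Finset (Fin N)} (hS : S.Nonempty) (c : OracleCall)
    (ψ : BasisState N r d → ℂ) : ∑ z, ‖c.apply S ψ z‖ ^ 2 = ∑ z, ‖ψ z‖ ^ 2 := by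
  cases c with
  | query => exact sum_norm_sq_applyQuery S ψ
  | reflection => exact sum_norm_sq_applyReflection hS ψ
  | controlledReflection => exact sum_norm_sq_applyControlledReflection hS ψ

namespace QuantumAlgorithm

theorem sum_norm_sq_initialState (Q : QuantumAlgorithm N) {S : Finset (Fin N)} (hS : S.Nonempty) :
    ∑ z, ‖Q.initialState S z‖ ^ 2 = 1 := by
  rw [Fintype.sum_prod_type]
  have h : ∀ x t, ‖Q.initialState S (x, t)‖ ^ 2 =
      (∏ k, ‖sampleState S (x k)‖ ^ 2) * if t = Q.start then 1 else 0 := by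
    intro x t
    by_cases ht : t = Q.start <;> simp [initialState, ht, Finset.prod_pow]
  simp only [h, ← Finset.mul_sum, Finset.sum_ite_eq', Finset.mem_univ, if_true, mul_one]
  have := Finset.prod_univ_sum (fun _ : Fin Q.copies => (Finset.univ : Finset (Fin N)))
    (fun _ i => ‖sampleState S i‖ ^ 2)
  rw [Fintype.piFinset_univ] at this
  rw [← this]
  simp [sum_norm_sq_sampleState hS]

theorem sum_norm_sq_finalState (Q : QuantumAlgorithm N) {S : Finset (Fin N)} (hS : S.Nonempty) :
    ∑ z, ‖Q.finalState S z‖ ^ 2 = 1 := by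
  have h : ∀ (l : List (OracleCall × Matrix.unitaryGroup (BasisState N Q.copies Q.ancillaDim) ℂ))
      (ψ : Q.State), ∑ z, ‖l.foldl (fun φ s => s.2.1.mulVec (s.1.apply S φ)) ψ z‖ ^ 2 =
        ∑ z, ‖ψ z‖ ^ 2 := by
    intro l
    induction l with
    | nil => intro ψ; rfl
    | cons s l ih =>
      intro ψ
      rw [List.foldl_cons, ih, sum_norm_sq_mulVec, s.1.sum_norm_sq_apply hS]
  rw [finalState, h, sum_norm_sq_mulVec, Q.sum_norm_sq_initialState hS]

theorem outputProb_nonneg (Q : QuantumAlgorithm N) (S : Finset (Fin N)) (b : Bool) :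
    0 ≤ Q.outputProb S b :=
  Finset.sum_nonneg fun z _ => by split_ifs <;> positivity

theorem outputProb_add (Q : QuantumAlgorithm N) {S : Finset (Fin N)} (hS : S.Nonempty) :
    Q.outputProb S false + Q.outputProb S true = 1 := by
  rw [← Q.sum_norm_sq_finalState hS, outputProb, outputProb, ← Finset.sum_add_distrib]
  refine Finset.sum_congr rfl fun z _ => ?_
  cases Q.output z <;> simp

end QuantumAlgorithm

end

/-! ### The averaged acceptance probability as a Laurent polynomial. -/

namespace QuantumAlgorithm

variable {N : ℕ}

/-- The probability that `Q` outputs `true`, averaged over the hidden sets of size `k`. -/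
noncomputable def averageProb (Q : QuantumAlgorithm N) (k : ℕ) : ℝ :=
  (∑ S ∈ Finset.univ.powersetCard k, Q.outputProb S true) / N.choose k

theorem averageProb_mem_Icc (Q : QuantumAlgorithm N) {k : ℕ} (hk : 1 ≤ k) (hkN : k ≤ N)
    {l h : ℝ} (hlh : ∀ S : Finset (Fin N), S.Nonempty → S.card = k →
      Q.outputProb S true ∈ Set.Icc l h) : Q.averageProb k ∈ Set.Icc l h := by
  have h0 : (0 : ℝ) < N.choose k := by exact_mod_cast Nat.choose_pos hkN
  have hS : ∀ S ∈ Finset.univ.powersetCard k, Q.outputProb S true ∈ Set.Icc l h := by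
    intro S hS
    have hc := (Finset.mem_powersetCard.mp hS).2
    exact hlh S (Finset.card_pos.mp (by omega)) hc
  have hcard : (Finset.univ.powersetCard k : Finset (Finset (Fin N))).card = N.choose k := by simp
  constructor
  · rw [averageProb, le_div_iff₀ h0]
    have := Finset.card_nsmul_le_sum _ _ l fun S hS' => (hS S hS').1
    rw [hcard, nsmul_eq_mul] at this
    linarith
  · rw [averageProb, div_le_iff₀ h0]
    have := Finset.sum_le_card_nsmul _ _ h fun S hS' => (hS S hS').2
    rw [hcard, nsmul_eq_mul] at this
    linarith

open Polynomial in
theorem exists_laurent_averageProb (Q : QuantumAlgorithm N) :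
    ∃ (u v : ℝ[X]) (v₀ : ℝ), u.natDegree ≤ 2 * Q.queries + (Q.copies + 2 * Q.reflections) ∧
      v.natDegree ≤ Q.copies + 2 * Q.reflections ∧ u.eval 0 = 0 ∧ v.eval 0 = 0 ∧
      ∀ k : ℕ, 1 ≤ k → k ≤ N → u.eval (k : ℝ) + v₀ + v.eval (k : ℝ)⁻¹ = Q.averageProb k := by
  obtain ⟨f, hf, hf'⟩ := Q.exists_lowDegree_outputProb true
  obtain ⟨p, hp, hp'⟩ := exists_polynomial_sum_powersetCard hf
  obtain ⟨P, hP, hP'⟩ := exists_real_polynomial_re hp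
  -- The numerator has degree at most `2(T + m) = (2T + m) + m`, and the denominator is `k^m`.
  obtain ⟨u, v, v₀, hu, hv, hu0, hv0, h⟩ := exists_laurent_decomposition
    (D := 2 * Q.queries + (Q.copies + 2 * Q.reflections)) (m := Q.copies + 2 * Q.reflections)
    (P := P) (hP.trans (by omega))
  refine ⟨u, v, v₀, hu, hv, hu0, hv0, fun k hk hkN => ?_⟩
  have hk0 : (k : ℝ) ≠ 0 := by exact_mod_cast (by omega : k ≠ 0)
  have h0 : (N.choose k : ℝ) ≠ 0 := by exact_mod_cast (Nat.choose_pos hkN).ne'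
  have hsum : ∑ S ∈ Finset.univ.powersetCard k, f S =
      (((k : ℝ) ^ (Q.copies + 2 * Q.reflections) *
        ∑ S ∈ Finset.univ.powersetCard k, Q.outputProb S true : ℝ) : ℂ) := by
    rw [Finset.mul_sum, Complex.ofReal_sum]
    refine Finset.sum_congr rfl fun S hS => ?_
    have hc := (Finset.mem_powersetCard.mp hS).2
    rw [hf' S (Finset.card_pos.mp (by omega)), hc]
    push_cast
    rfl
  have hre := congrArg Complex.re ((hp' k hkN).symm.trans hsum)
  rw [Complex.ofReal_re, ← Complex.ofReal_natCast, Complex.re_ofReal_mul,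
    ← Complex.ofReal_natCast, ← hP'] at hre
  rw [← h _ hk0, averageProb, div_eq_div_iff (pow_ne_zero _ hk0) h0]
  linarith

end QuantumAlgorithm

/-! ### The lower bound. -/

theorem mainTheorem9 :
    ∃ c : ℝ, 0 < c ∧
      ∀ (N w : ℕ), 1 ≤ w → 2 * w ≤ N →
        ∀ Q : QuantumAlgorithm N, Q.Decides w (2 * w) →
          c * Real.sqrt ((N : ℝ) / (w : ℝ)) ≤ (Q.queries : ℝ) ∨
          c * min ((w : ℝ) ^ ((1 : ℝ) / 4)) (Real.sqrt ((N : ℝ) / (w : ℝ))) ≤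
            ((Q.copies + Q.reflections : ℕ) : ℝ) := by
  -- As `m ≤ 2R`, this constant gives `m ≤ w^(1/4) / 100` and `2T + m ≤ √(N/w) / 50`, with room for
  -- the numerical conditions of `laurent_abs_sub_le`.
  refine ⟨1 / 200, by norm_num, fun N w hw hwN Q hQ => ?_⟩
  by_contra! hcon
  obtain ⟨hT, hR⟩ := hcon
  obtain ⟨u, v, v₀, hu, hv, hu0, hv0, hq⟩ := Q.exists_laurent_averageProb
  set m := Q.copies + 2 * Q.reflections with hmdef
  have hw0 : (0 : ℝ) < w := by exact_mod_cast hw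
  have hm2 : (m : ℝ) ≤ 2 * ((Q.copies + Q.reflections : ℕ) : ℝ) := by
    exact_mod_cast (by omega : m ≤ 2 * (Q.copies + Q.reflections))
  have hmw : (m : ℝ) ≤ 1 / 100 * (w : ℝ) ^ ((1 : ℝ) / 4) := by
    linarith [min_le_left ((w : ℝ) ^ ((1 : ℝ) / 4)) (Real.sqrt ((N : ℝ) / (w : ℝ)))]
  have hms : (m : ℝ) ≤ 1 / 100 * Real.sqrt ((N : ℝ) / (w : ℝ)) := by
    linarith [min_le_right ((w : ℝ) ^ ((1 : ℝ) / 4)) (Real.sqrt ((N : ℝ) / (w : ℝ)))]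
  have hD : 800 * w * (2 * Q.queries + m) ^ 2 ≤ N := by
    have h1 : (2 * Q.queries + m : ℝ) ≤ 1 / 50 * Real.sqrt ((N : ℝ) / (w : ℝ)) := by linarith
    have h2 : (2 * Q.queries + m : ℝ) ^ 2 ≤ 1 / 2500 * ((N : ℝ) / w) := by
      calc (2 * Q.queries + m : ℝ) ^ 2 ≤ (1 / 50 * Real.sqrt ((N : ℝ) / (w : ℝ))) ^ 2 := by gcongr
        _ = 1 / 2500 * ((N : ℝ) / w) := by
          rw [mul_pow, Real.sq_sqrt (by positivity)]
          norm_num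
    have h3 : 800 * (w : ℝ) * (2 * Q.queries + m : ℝ) ^ 2 ≤ N := by
      calc 800 * (w : ℝ) * (2 * Q.queries + m : ℝ) ^ 2
          ≤ 800 * (w : ℝ) * (1 / 2500 * ((N : ℝ) / w)) := by gcongr
        _ = 8 / 25 * N := by field_simp; ring
        _ ≤ N := by linarith [(Nat.cast_nonneg N : (0 : ℝ) ≤ N)]
    exact_mod_cast h3
  have hm4 : 100000000 * m ^ 4 ≤ w := by
    have h1 : (m : ℝ) ^ 4 ≤ 1 / 100000000 * w := by
      calc (m : ℝ) ^ 4 ≤ (1 / 100 * (w : ℝ) ^ ((1 : ℝ) / 4)) ^ 4 := by gcongr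
        _ = 1 / 100000000 * (w : ℝ) := by
          rw [mul_pow, ← Real.rpow_natCast ((w : ℝ) ^ ((1 : ℝ) / 4)), ← Real.rpow_mul hw0.le]
          norm_num
    have h2 : 100000000 * (m : ℝ) ^ 4 ≤ w := by linarith
    exact_mod_cast h2
  have hm24 : m ^ 2 ≤ m ^ 4 := by
    rcases Nat.eq_zero_or_pos m with h | h
    · simp [h]
    · exact Nat.pow_le_pow_right h (by norm_num)
  have hr : ∀ k : ℕ, 400 * m ^ 2 + 1 ≤ k → k ≤ N →
      |u.eval (k : ℝ) + v₀ + v.eval (k : ℝ)⁻¹| ≤ 1 := by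
    intro k hk hkN
    have hk1 : 1 ≤ k := by omega
    have := Q.averageProb_mem_Icc (l := 0) (h := 1) hk1 hkN fun S hS _ =>
      ⟨Q.outputProb_nonneg S true, by
        linarith [Q.outputProb_add hS, Q.outputProb_nonneg S false]⟩
    rw [hq k hk1 hkN, abs_le]
    exact ⟨by linarith [this.1], this.2⟩
  -- The choice `a = 400m² + 1` keeps `a ≥ 1` even when `m = 0`; then `400m²a` is at most
  -- `160400m⁴`, well below `w`'s lower bound `10⁸m⁴`.
  have hgap := laurent_abs_sub_le hu hv hu0 hv0 (by omega : 1 ≤ 400 * m ^ 2 + 1)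
    (by
      rcases Nat.eq_zero_or_pos m with h | h
      · simpa [h] using hw
      · have : 1 ≤ m ^ 4 := Nat.one_le_pow _ _ h
        omega) hwN hr hD (by omega) (by nlinarith)
  have h1 := Q.averageProb_mem_Icc (l := 0) (h := 1 / 3) hw (by omega) fun S hS hc =>
    ⟨Q.outputProb_nonneg S true, by linarith [Q.outputProb_add hS, (hQ S).1 hc]⟩
  have h2 := Q.averageProb_mem_Icc (l := 2 / 3) (h := 1) (by omega : 1 ≤ 2 * w) hwN fun S hS hc =>
    ⟨(hQ S).2 hc, by linarith [Q.outputProb_add hS, Q.outputProb_nonneg S false]⟩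
  rw [← hq w hw (by omega)] at h1
  rw [← hq (2 * w) (by omega) hwN] at h2
  push_cast at h2
  rw [abs_le] at hgap
  linarith [h1.2, h2.1, hgap.2]
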